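/- Let $(A,\mu)$ be a Lie algebroid over a smooth manifold $M$, with anchor $\rho$ and bracket $[\ ,\ ]$ on $\Gamma A$; all tensors are smooth. For a bivector $\pi\in\Gamma(\wedge^2A)$ let $\pi^\sharp:A^*\to A$, $\pi^\sharp\alpha=i_\alpha\pi$, and for a $2$-form $\omega\in\Gamma(\wedge^2A^*)$ let $\omega^\flat:A\to A^*$, $\omega^\flat X=-i_X\omega$; $\pi$ (resp. $\omega$) is non-degenerate if $\pi^\sharp$ (resp. $\omega^\flat$) is an isomorphism. Let $N$ be a $(1,1)$-tensor on $A$, viewed as a bundle endomorphism of $A$, with transpose $N^*$. Its deformed structure $\mu_N$ has anchor $\rho\circ N$ and bracket $[X,Y]_N=[NX,Y]+[X,NY]-N[X,Y]$, and $N$ is a Nijenhuis tensor if $[NX,NY]-N([NX,Y]+[X,NY])+N^2[X,Y]=0$ for all $X,Y\in\Gamma A$. Let $d_\mu$ be the Lie algebroid differential on forms and $[\ ,\ ]_\pi$ the Koszul bracket, $[\alpha,\beta]_\pi=\mathcal L_{\pi^\sharp\alpha}\beta-\mathcal L_{\pi^\sharp\beta}\alpha-d_\mu(\pi(\alpha,\beta))$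 for $\alpha,\beta\in\Gamma(A^*)$. The pair $(\pi,N)$ is a PN-structure on $(A,\mu)$ if $\pi$ is Poisson (its Schouten bracket $[\pi,\pi]_\mu$ vanishes), $N$ is a Nijenhuis tensor, $N\circ\pi^\sharp=\pi^\sharp\circ N^*$, and the Koszul bracket formed from $\pi$ and $\mu_N$ in place of $\mu$ equals $[N^*\alpha,\beta]_\pi+[\alpha,N^*\beta]_\pi-N^*[\alpha,\beta]_\pi$ for all $\alpha,\beta\in\Gamma(A^*)$. The pair $(\omega,N)$ is an $\Omega N$-structure on $(A,\mu)$ if $\omega^\flat\circ N=N^*\circ\omega^\flat$, $d_\mu\omega=0$, $N$ is a Nijenhuis tensor, and $d_\mu(\omega_N)=0$, where $\omega_N$ is the $2$-form with $\omega_N^\flat=\omega^\flat\circ N$. Theorem. If $(\omega,N)$ is an $\Omega N$-structure on $(A,\mu)$ and $\omega$ is non-degenerate, then $\pi^\sharp=N\circ(\omega^\flat)^{-1}$ defines a bivector $\pi$ and $(\pi,N)$ is a PN-structure on $(A,\mu)$. Conversely, if $(\pi,N)$ is a PN-structure on $(A,\mu)$ and $\pi$ is non-degenerate, then $\omega^\flat=(\pi^\sharp)^{-1}\circ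 N$ defines a $2$-form $\omega$ and $(\omega,N)$ is an $\Omega N$-structure on $(A,\mu)$. -/

import Mathlib

open Bundle
open scoped Manifold ContDiff Bundle Topology

noncomputable section

namespace LieAlgd

section Sections

variable {E : Type*} [NormedAddCommGroup E] [NormedSpace ℝ E]
  {H : Type*} [TopologicalSpace H] {I : ModelWithCorners ℝ E H}
  {M : Type*} [TopologicalSpace M] [ChartedSpace H M]
  {F₁ : Type*} [NormedAddCommGroup F₁] [NormedSpace ℝ F₁]
  {A₁ : M → Type*} [TopologicalSpace (TotalSpace F₁ A₁)]
  [∀ x, AddCommGroup (A₁ x)] [∀ x, Module ℝ (A₁ x)] [∀ x, TopologicalSpace (A₁ x)]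
  [FiberBundle F₁ A₁] [VectorBundle ℝ F₁ A₁]
  {F₂ : Type*} [NormedAddCommGroup F₂] [NormedSpace ℝ F₂]
  {A₂ : M → Type*} [TopologicalSpace (TotalSpace F₂ A₂)]
  [∀ x, AddCommGroup (A₂ x)] [∀ x, Module ℝ (A₂ x)] [∀ x, TopologicalSpace (A₂ x)]
  [FiberBundle F₂ A₂] [VectorBundle ℝ F₂ A₂]
  [∀ x, IsTopologicalAddGroup (A₂ x)] [∀ x, ContinuousSMul ℝ (A₂ x)]
  {F₃ : Type*} [NormedAddCommGroup F₃] [NormedSpace ℝ F₃]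
  {A₃ : M → Type*} [TopologicalSpace (TotalSpace F₃ A₃)]
  [∀ x, AddCommGroup (A₃ x)] [∀ x, Module ℝ (A₃ x)] [∀ x, TopologicalSpace (A₃ x)]
  [FiberBundle F₃ A₃] [VectorBundle ℝ F₃ A₃]
  [∀ x, IsTopologicalAddGroup (A₃ x)] [∀ x, ContinuousSMul ℝ (A₃ x)]

/-- A smooth vector bundle map over the identity, applied pointwise to a smooth section. -/
def applySec (T : Cₛ^∞⟮I; F₁ →L[ℝ] F₂, fun x => A₁ x →L[ℝ] A₂ x⟯)
    (X : Cₛ^∞⟮I; F₁, A₁⟯) : Cₛ^∞⟮I; F₂, A₂⟯ where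
  toFun x := T x (X x)
  contMDiff_toFun := ContMDiff.clm_bundle_apply T.contMDiff X.contMDiff

/-- Pointwise composition of smooth vector bundle maps over the identity. -/
def compSec (S : Cₛ^∞⟮I; F₂ →L[ℝ] F₃, fun x => A₂ x →L[ℝ] A₃ x⟯)
    (T : Cₛ^∞⟮I; F₁ →L[ℝ] F₂, fun x => A₁ x →L[ℝ] A₂ x⟯) :
    Cₛ^∞⟮I; F₁ →L[ℝ] F₃, fun x => A₁ x →L[ℝ] A₃ x⟯ where
  toFun x := (S x).comp (T x)
  contMDiff_toFun := by
    intro x₀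
    have hS := (contMDiffAt_hom_bundle _).1 (S.contMDiff x₀)
    have hT := (contMDiffAt_hom_bundle _).1 (T.contMDiff x₀)
    refine (contMDiffAt_hom_bundle _).2 ⟨hS.1, (hS.2.clm_comp hT.2).congr_of_eventuallyEq ?_⟩
    have h₁ : ∀ᶠ x in 𝓝 x₀, x ∈ (trivializationAt F₁ A₁ x₀).baseSet :=
      (trivializationAt F₁ A₁ x₀).open_baseSet.mem_nhds
        (FiberBundle.mem_baseSet_trivializationAt' x₀)
    have h₂ : ∀ᶠ x in 𝓝 x₀, x ∈ (trivializationAt F₂ A₂ x₀).baseSet :=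
      (trivializationAt F₂ A₂ x₀).open_baseSet.mem_nhds
        (FiberBundle.mem_baseSet_trivializationAt' x₀)
    have h₃ : ∀ᶠ x in 𝓝 x₀, x ∈ (trivializationAt F₃ A₃ x₀).baseSet :=
      (trivializationAt F₃ A₃ x₀).open_baseSet.mem_nhds
        (FiberBundle.mem_baseSet_trivializationAt' x₀)
    filter_upwards [h₁, h₂, h₃] with x hx₁ hx₂ hx₃
    ext v
    simp [ContinuousLinearMap.inCoordinates_eq, hx₁, hx₂, hx₃]

end Sections

section Algebroids

variable {E : Type*} [NormedAddCommGroup E] [NormedSpace ℝ E]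
  {H : Type*} [TopologicalSpace H] (I : ModelWithCorners ℝ E H)
  {M : Type*} [TopologicalSpace M] [ChartedSpace H M] [IsManifold I ∞ M]
  (F : Type*) [NormedAddCommGroup F] [NormedSpace ℝ F]
  (A : M → Type*) [TopologicalSpace (TotalSpace F A)]
  [∀ x, AddCommGroup (A x)] [∀ x, Module ℝ (A x)] [∀ x, TopologicalSpace (A x)]
  [FiberBundle F A] [VectorBundle ℝ F A]

/-- The dual bundle `A^*`. -/
abbrev DualBundle (x : M) : Type _ := A x →L[ℝ] Bundle.Trivial M ℝ x

/-- Smooth sections of `A`. -/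
abbrev Sec := Cₛ^∞⟮I; F, A⟯

/-- Smooth sections of `A^*`, that is, `1`-forms on `A`. -/
abbrev OneForm := Cₛ^∞⟮I; F →L[ℝ] ℝ, DualBundle A⟯

variable {I F A}

/-- The product of a smooth function and a smooth section. -/
def smulSec (f : C^∞⟮I, M; ℝ⟯) (X : Sec I F A) : Sec I F A where
  toFun x := f x • X x
  contMDiff_toFun := ContMDiff.smul_section f.contMDiff X.contMDiff

/-- The function `⟨α, X⟩`. -/
def pairing (α : OneForm I F A) (X : Sec I F A) (x : M) : ℝ := α x (X x)

variable (I F A)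

/-- An anchor `ρ : A → TM` together with a skew-symmetric bracket on the sections of `A`
satisfying the Leibniz rule `[X, f Y] = f [X, Y] + (ρ(X) f) Y`. The Jacobi identity is not
required: such a pair is the same as a function of shifted bidegree `(0,1)` on `T^*[2]A[1]`. -/
structure PreLieAlgebroid where
  anchor : Cₛ^∞⟮I; F →L[ℝ] E, fun x => A x →L[ℝ] TangentSpace I x⟯
  bracket : Sec I F A → Sec I F A → Sec I F A
  bracket_skew : ∀ X Y, bracket X Y = -bracket Y X
  bracket_add : ∀ X Y Z, bracket X (Y + Z) = bracket X Y + bracket X Z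
  leibniz : ∀ (X Y : Sec I F A) (f : C^∞⟮I, M; ℝ⟯) (x : M),
    bracket X (smulSec f Y) x =
      f x • bracket X Y x + (mvfderiv I f x (anchor x (X x)) : ℝ) • Y x

/-- A Lie algebroid structure on `A → M`. -/
structure LieAlgebroid extends PreLieAlgebroid I F A where
  jacobi : ∀ X Y Z, bracket X (bracket Y Z) = bracket (bracket X Y) Z + bracket Y (bracket X Z)

variable {I F A}

namespace PreLieAlgebroid

/-- `ρ(X) f`, the derivative of a function along a section of `A`. -/
def deriv (μ : PreLieAlgebroid I F A) (X : Sec I F A) (f : M → ℝ) (x : M) : ℝ :=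
  mvfderiv I f x (μ.anchor x (X x))

/-- The Lie derivative of a `1`-form, `⟨L_X β, Y⟩ = ρ(X)⟨β, Y⟩ - ⟨β, [X, Y]⟩`. -/
def lieDeriv (μ : PreLieAlgebroid I F A) (X : Sec I F A) (β : OneForm I F A)
    (Y : Sec I F A) (x : M) : ℝ :=
  μ.deriv X (pairing β Y) x - pairing β (μ.bracket X Y) x

end PreLieAlgebroid

variable [∀ x, IsTopologicalAddGroup (A x)] [∀ x, ContinuousSMul ℝ (A x)]

variable (I F A) in
/-- A `(1,1)`-tensor on `A`, viewed as a smooth vector bundle endomorphism of `A`. -/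
abbrev Endo := Cₛ^∞⟮I; F →L[ℝ] F, fun x => A x →L[ℝ] A x⟯

variable (I F A) in
/-- A `2`-form `Ω` on `A` : `form x u v = Ω_x(u, v)`, alternating, smooth in `x`. -/
structure TwoForm where
  form : Cₛ^∞⟮I; F →L[ℝ] F →L[ℝ] ℝ, fun x => A x →L[ℝ] DualBundle A x⟯
  alternating : ∀ x u, form x u u = 0

variable (I F A) in
/-- A bivector `P` on `A`, a section of `∧² A`, given by the map `P^♯ : A^* → A`,
`P^♯ α = i_α P`, so that `P(α, β) = ⟨β, P^♯ α⟩` is alternating. -/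
structure Bivector where
  sharp : Cₛ^∞⟮I; (F →L[ℝ] ℝ) →L[ℝ] F, fun x => DualBundle A x →L[ℝ] A x⟯
  alternating : ∀ x (α : DualBundle A x), α (sharp x α) = 0

/-- The transpose `N^*` applied to a `1`-form: `⟨N^* α, X⟩ = ⟨α, N X⟩`. -/
def transpose (N : Endo I F A) (α : OneForm I F A) : OneForm I F A := compSec α N

namespace TwoForm

/-- `Ω^♭ : A → A^*`, `Ω^♭ X = - i_X Ω`. -/
def flat (Ω : TwoForm I F A) (x : M) : A x →L[ℝ] DualBundle A x := -Ω.form x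

/-- The function `Ω(X, Y)`. -/
def eval (Ω : TwoForm I F A) (X Y : Sec I F A) (x : M) : ℝ := Ω.form x (X x) (Y x)

/-- `Ω` is non-degenerate: `Ω^♭` is an isomorphism in each fibre. -/
def Nondegenerate (Ω : TwoForm I F A) : Prop := ∀ x, Function.Bijective (Ω.flat x)

/-- `(d_μ Ω)(X, Y, Z)`, by the Cartan formula. -/
def differential (μ : PreLieAlgebroid I F A) (Ω : TwoForm I F A) (X Y Z : Sec I F A)
    (x : M) : ℝ :=
  μ.deriv X (Ω.eval Y Z) x + μ.deriv Y (Ω.eval Z X) x + μ.deriv Z (Ω.eval X Y) x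
    - Ω.eval (μ.bracket X Y) Z x - Ω.eval (μ.bracket Y Z) X x - Ω.eval (μ.bracket Z X) Y x

/-- `d_μ Ω = 0`. -/
def IsClosed (μ : PreLieAlgebroid I F A) (Ω : TwoForm I F A) : Prop :=
  ∀ X Y Z x, Ω.differential μ X Y Z x = 0

/-- `Ω^♭ ∘ N = N^* ∘ Ω^♭`. -/
def Commutes (Ω : TwoForm I F A) (N : Endo I F A) : Prop :=
  ∀ x (u : A x), Ω.flat x (N x u) = (Ω.flat x u).comp (N x)

/-- The `2`-form `Ω_N` with `Ω_N^♭ = Ω^♭ ∘ N`, when `Ω^♭ ∘ N = N^* ∘ Ω^♭`. -/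
def deform (Ω : TwoForm I F A) (N : Endo I F A) (h : Ω.Commutes N) : TwoForm I F A where
  form := compSec Ω.form N
  alternating := by
    intro x u
    have h1 := DFunLike.congr_fun (h x u) u
    have h2 := Ω.alternating x (N x u + u)
    have h3 := Ω.alternating x (N x u)
    have h4 := Ω.alternating x u
    simp only [map_add, add_apply, h3, h4] at h2
    change -(Ω.form x (N x u) u) = -(Ω.form x u (N x u)) at h1
    change Ω.form x (N x u) u = 0
    change (0 : ℝ) + (Ω.form x u (N x u) : ℝ) + ((Ω.form x (N x u) u : ℝ) + 0) = 0 at h2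
    change -(Ω.form x (N x u) u : ℝ) = -(Ω.form x u (N x u) : ℝ) at h1
    linarith

theorem flat_deform (Ω : TwoForm I F A) (N : Endo I F A) (h : Ω.Commutes N) (x : M) :
    (Ω.deform N h).flat x = (Ω.flat x).comp (N x) := by
  ext u v
  rfl

end TwoForm

namespace Bivector

/-- The function `P(α, β) = ⟨β, P^♯ α⟩`. -/
def eval (P : Bivector I F A) (α β : OneForm I F A) (x : M) : ℝ := β x (P.sharp x (α x))

/-- `P` is non-degenerate: `P^♯` is an isomorphism in each fibre. -/
def Nondegenerate (P : Bivector I F A) : Prop := ∀ x, Function.Bijective (P.sharp x)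

/-- `N ∘ P^♯ = P^♯ ∘ N^*`. -/
def Commutes (P : Bivector I F A) (N : Endo I F A) : Prop :=
  ∀ x (α : DualBundle A x), N x (P.sharp x α) = P.sharp x (α.comp (N x))

/-- The Koszul bracket of `1`-forms, paired with a section `Y` of `A`:
`[α, β]_P = L_{P^♯ α} β - L_{P^♯ β} α - d_μ (P(α, β))`. It is the bracket on `A^*` defined by
`{P, μ}`. -/
def koszul (μ : PreLieAlgebroid I F A) (P : Bivector I F A) (α β : OneForm I F A)
    (Y : Sec I F A) (x : M) : ℝ :=
  μ.lieDeriv (applySec P.sharp α) β Y x - μ.lieDeriv (applySec P.sharp β) α Y x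
    - μ.deriv Y (P.eval α β) x

/-- The bracket `[α, β]_P` deformed by `N^*`, paired with a section `Y` of `A`:
`[N^* α, β]_P + [α, N^* β]_P - N^* [α, β]_P`. -/
def deformedKoszul (μ : PreLieAlgebroid I F A) (P : Bivector I F A) (N : Endo I F A)
    (α β : OneForm I F A) (Y : Sec I F A) (x : M) : ℝ :=
  P.koszul μ (transpose N α) β Y x + P.koszul μ α (transpose N β) Y x
    - P.koszul μ α β (applySec N Y) x

/-- The Schouten bracket `[P, P]_μ = {{P, μ}, P}` on `1`-forms `α, β, γ`. It is the differential of
`P`, as a `2`-form on `A^*`, for the anchor `ρ ∘ P^♯` and the Koszul bracket `[ , ]_P`, that is,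
the cyclic sum of `ρ(P^♯ α)(P(β, γ)) - P([α, β]_P, γ)`;
here `P(ξ, γ) = -P(γ, ξ) = -⟨ξ, P^♯ γ⟩`. -/
def schouten (μ : PreLieAlgebroid I F A) (P : Bivector I F A) (α β γ : OneForm I F A)
    (x : M) : ℝ :=
  μ.deriv (applySec P.sharp α) (P.eval β γ) x + P.koszul μ α β (applySec P.sharp γ) x
    + μ.deriv (applySec P.sharp β) (P.eval γ α) x + P.koszul μ β γ (applySec P.sharp α) x
    + μ.deriv (applySec P.sharp γ) (P.eval α β) x + P.koszul μ γ α (applySec P.sharp β) x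

/-- `P` is a Poisson bivector: `[P, P]_μ = 0`. -/
def IsPoisson (μ : PreLieAlgebroid I F A) (P : Bivector I F A) : Prop :=
  ∀ α β γ x, P.schouten μ α β γ x = 0

end Bivector

namespace PreLieAlgebroid

/-- The deformed structure `μ_N = {N, μ}`: anchor `ρ ∘ N` and bracket
`[X, Y]_N = [N X, Y] + [X, N Y] - N [X, Y]`. -/
def deform (μ : PreLieAlgebroid I F A) (N : Endo I F A) : PreLieAlgebroid I F A where
  anchor := compSec μ.anchor N
  bracket X Y := μ.bracket (applySec N X) Y + μ.bracket X (applySec N Y)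
    - applySec N (μ.bracket X Y)
  bracket_skew := by
    intro X Y
    rw [μ.bracket_skew (applySec N X) Y, μ.bracket_skew X (applySec N Y), μ.bracket_skew X Y]
    ext x
    simp [applySec]
    abel
  bracket_add := by
    intro X Y Z
    have h : applySec N (Y + Z) = applySec N Y + applySec N Z := by
      ext x
      simp [applySec]
    rw [h, μ.bracket_add, μ.bracket_add, μ.bracket_add]
    ext x
    simp [applySec]
    abel
  leibniz := by
    intro X Y f x
    have h : applySec N (smulSec f Y) = smulSec f (applySec N Y) := by
      ext x
      simp [applySec, smulSec]
    rw [h]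
    have h1 := μ.leibniz (applySec N X) Y f x
    have h2 := μ.leibniz X (applySec N Y) f x
    have h3 := μ.leibniz X Y f x
    simp only [ContMDiffSection.coe_add, ContMDiffSection.coe_sub, Pi.add_apply, Pi.sub_apply,
      h1, h2]
    have h4 : applySec N (μ.bracket X (smulSec f Y)) x = N x (μ.bracket X (smulSec f Y) x) := rfl
    rw [h4, h3]
    have h5 : compSec μ.anchor N x (X x) = μ.anchor x (applySec N X x) := rfl
    have h6 : applySec N Y x = N x (Y x) := rfl
    have h7 : applySec N (μ.bracket X Y) x = N x (μ.bracket X Y x) := rfl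
    rw [h5, h6, h7, map_add, map_smul, map_smul]
    module

/-- The Nijenhuis torsion `[N X, N Y] - N ([N X, Y] + [X, N Y]) + N² [X, Y]`. -/
def torsion (μ : PreLieAlgebroid I F A) (N : Endo I F A) (X Y : Sec I F A) : Sec I F A :=
  μ.bracket (applySec N X) (applySec N Y)
    - applySec N (μ.bracket (applySec N X) Y + μ.bracket X (applySec N Y))
    + applySec N (applySec N (μ.bracket X Y))

/-- `N` is a Nijenhuis tensor: its Nijenhuis torsion vanishes. -/
def IsNijenhuis (μ : PreLieAlgebroid I F A) (N : Endo I F A) : Prop :=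
  ∀ X Y, μ.torsion N X Y = 0

end PreLieAlgebroid

/-- `P` and `N` are compatible: `N ∘ P^♯ = P^♯ ∘ N^*`, and the bracket `[ , ]_N` twisted by `P`
(the one defined by `{P, {N, μ}}`) equals the bracket `[ , ]_P` deformed by `N^*` (the one defined
by `{{P, μ}, N}`), that is, `C_μ(P, N) = {P, {N, μ}} + {N, {P, μ}} = 0`. -/
structure Compatible (μ : PreLieAlgebroid I F A) (P : Bivector I F A) (N : Endo I F A) :
    Prop where
  commutes : P.Commutes N
  bracket_eq : ∀ α β Y x, P.koszul (μ.deform N) α β Y x = P.deformedKoszul μ N α β Y x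

/-- `(P, N)` is a `PN`-structure on `(A, μ)`. -/
structure IsPN (μ : LieAlgebroid I F A) (P : Bivector I F A) (N : Endo I F A) : Prop where
  poisson : P.IsPoisson μ.toPreLieAlgebroid
  nijenhuis : μ.IsNijenhuis N
  compatible : Compatible μ.toPreLieAlgebroid P N

/-- `(Ω, N)` is an `ΩN`-structure on `(A, μ)`. -/
structure IsOmegaN (μ : LieAlgebroid I F A) (Ω : TwoForm I F A) (N : Endo I F A) : Prop where
  commutes : Ω.Commutes N
  closed : Ω.IsClosed μ.toPreLieAlgebroid
  nijenhuis : μ.IsNijenhuis N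
  closed_deform : (Ω.deform N commutes).IsClosed μ.toPreLieAlgebroid

end Algebroids

end LieAlgd

end

/-!
All identities are checked on global sections, so no local frames are needed. For a two-form `Ω`
commuting with `N`, the Cartan formula gives `d_{μ_N} Ω = i_N (d_μ Ω) - 2 d_μ Ω_N`
(`TwoForm.differential_deform`). If moreover `Ω` and `Ω_N` are closed and `N` is a Nijenhuis
tensor, then `d_μ Ω_{N²} = 0` and a cyclic sum which computes a Schouten bracket vanishes: the two
are related by two independent linear equations
(`TwoForm.cyclic_sum_and_differential_eq_zero`).

Let `Ω` be non-degenerate, so that every one-form is `Ω^♭ X` for a section `X`, and let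
`P^♯ = N ∘ (Ω^♭)⁻¹`. When `Ω` and `Ω_N` are closed, `[Ω^♭ X, Ω^♭ Y]_P = Ω^♭ [X, Y]_N`
(`Bivector.koszul_flatSec_of_endo`). Since `N [X, Y]_N = [N X, N Y]`, the Schouten bracket of `P` is
the cyclic sum above. The forms `Ω` and `Ω_N` are also closed for `μ_N`, so the same formula applies
to `μ_N`; both sides of the compatibility condition become `Ω^♭` of the bracket of `X` and `Y`
deformed twice by `N`.

Conversely, let `P` be non-degenerate and let `Ω` be its inverse. Then
`[Ω^♭ X, Ω^♭ Y]_P = Ω^♭ [X, Y] - d_μ Ω (X, Y, ·)` (`Bivector.koszul_flatSec_of_inverse`), and the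
Schouten bracket of `P` is `-2 d_μ Ω`; so `Ω` is closed. The compatibility condition then says that
`d_{μ_N} Ω = 0`, that is, `Ω_N` is closed. Hence so is `Ω_{N²}`, and `(Ω_N, N)` is the required
structure, because `Ω_N^♭ = (P^♯)⁻¹ ∘ N`.
-/

open Bundle
open scoped Manifold ContDiff Bundle Topology

namespace LieAlgd

/-! ### Inverses of smooth vector bundle isomorphisms -/

/-- The open mapping theorem in a fibre. The fibres carry no norm, so the statement is transported
to the model fibres by trivializations. -/
theorem isInvertible_of_bijective {M : Type*} [TopologicalSpace M]
    (F₁ : Type*) [NormedAddCommGroup F₁] [NormedSpace ℝ F₁] [CompleteSpace F₁]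
    {A₁ : M → Type*} [TopologicalSpace (TotalSpace F₁ A₁)]
    [∀ x, AddCommGroup (A₁ x)] [∀ x, Module ℝ (A₁ x)] [∀ x, TopologicalSpace (A₁ x)]
    [FiberBundle F₁ A₁] [VectorBundle ℝ F₁ A₁]
    (F₂ : Type*) [NormedAddCommGroup F₂] [NormedSpace ℝ F₂] [CompleteSpace F₂]
    {A₂ : M → Type*} [TopologicalSpace (TotalSpace F₂ A₂)]
    [∀ x, AddCommGroup (A₂ x)] [∀ x, Module ℝ (A₂ x)] [∀ x, TopologicalSpace (A₂ x)]
    [FiberBundle F₂ A₂] [VectorBundle ℝ F₂ A₂]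
    {x : M} {T : A₁ x →L[ℝ] A₂ x} (hT : Function.Bijective T) : T.IsInvertible := by
  let e₁ : A₁ x ≃L[ℝ] F₁ := (trivializationAt F₁ A₁ x).continuousLinearEquivAt ℝ x
    (FiberBundle.mem_baseSet_trivializationAt' x)
  let e₂ : A₂ x ≃L[ℝ] F₂ := (trivializationAt F₂ A₂ x).continuousLinearEquivAt ℝ x
    (FiberBundle.mem_baseSet_trivializationAt' x)
  let S : F₁ →L[ℝ] F₂ := (e₂ : A₂ x →L[ℝ] F₂) ∘L T ∘L (e₁.symm : F₁ →L[ℝ] A₁ x)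
  have hS : Function.Bijective S := e₂.bijective.comp (hT.comp e₁.symm.bijective)
  let s : F₁ ≃L[ℝ] F₂ := ContinuousLinearEquiv.ofBijective S
    (LinearMap.ker_eq_bot.2 hS.1) (LinearMap.range_eq_top.2 hS.2)
  refine ⟨(e₁.trans s).trans e₂.symm, ?_⟩
  ext v
  simp [s, S]

section Inverse

variable {E : Type*} [NormedAddCommGroup E] [NormedSpace ℝ E]
  {H : Type*} [TopologicalSpace H] {I : ModelWithCorners ℝ E H}
  {M : Type*} [TopologicalSpace M] [ChartedSpace H M]
  {F₁ : Type*} [NormedAddCommGroup F₁] [NormedSpace ℝ F₁] [CompleteSpace F₁]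
  {A₁ : M → Type*} [TopologicalSpace (TotalSpace F₁ A₁)]
  [∀ x, AddCommGroup (A₁ x)] [∀ x, Module ℝ (A₁ x)] [∀ x, TopologicalSpace (A₁ x)]
  [FiberBundle F₁ A₁] [VectorBundle ℝ F₁ A₁]
  [∀ x, IsTopologicalAddGroup (A₁ x)] [∀ x, ContinuousSMul ℝ (A₁ x)]
  {F₂ : Type*} [NormedAddCommGroup F₂] [NormedSpace ℝ F₂] [CompleteSpace F₂]
  {A₂ : M → Type*} [TopologicalSpace (TotalSpace F₂ A₂)]
  [∀ x, AddCommGroup (A₂ x)] [∀ x, Module ℝ (A₂ x)] [∀ x, TopologicalSpace (A₂ x)]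
  [FiberBundle F₂ A₂] [VectorBundle ℝ F₂ A₂]
  [∀ x, IsTopologicalAddGroup (A₂ x)] [∀ x, ContinuousSMul ℝ (A₂ x)]

/-- The fibrewise inverse of a smooth vector bundle isomorphism over the identity. -/
noncomputable def invSec (T : Cₛ^∞⟮I; F₁ →L[ℝ] F₂, fun x => A₁ x →L[ℝ] A₂ x⟯)
    (hT : ∀ x, Function.Bijective (T x)) :
    Cₛ^∞⟮I; F₂ →L[ℝ] F₁, fun x => A₂ x →L[ℝ] A₁ x⟯ where
  toFun x := (T x).inverse
  contMDiff_toFun := by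
    intro x₀
    have hx₁ := FiberBundle.mem_baseSet_trivializationAt' (F := F₁) (E := A₁) x₀
    have hx₂ := FiberBundle.mem_baseSet_trivializationAt' (F := F₂) (E := A₂) x₀
    have h := (contMDiffAt_hom_bundle _).1 (T.contMDiff x₀)
    refine (contMDiffAt_hom_bundle _).2 ⟨h.1, ?_⟩
    -- In the trivializations at `x₀` the inverse is `ContinuousLinearMap.inverse` after a smooth
    -- map into `F₁ →L[ℝ] F₂`.
    have hinv :
        (ContinuousLinearMap.inCoordinates F₁ A₁ F₂ A₂ x₀ x₀ x₀ x₀ (T x₀)).IsInvertible := by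
      rw [ContinuousLinearMap.inCoordinates_eq hx₁ hx₂]
      obtain ⟨t, ht⟩ := isInvertible_of_bijective F₁ F₂ (hT x₀)
      rw [← ht]
      exact ⟨(((trivializationAt F₁ A₁ x₀).continuousLinearEquivAt ℝ x₀ hx₁).symm.trans t).trans
        ((trivializationAt F₂ A₂ x₀).continuousLinearEquivAt ℝ x₀ hx₂), rfl⟩
    have hc := (hinv.contDiffAt_map_inverse (n := ∞)).contMDiffAt.comp x₀ h.2
    refine hc.congr_of_eventuallyEq ?_
    filter_upwards [(trivializationAt F₁ A₁ x₀).open_baseSet.mem_nhds hx₁,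
      (trivializationAt F₂ A₂ x₀).open_baseSet.mem_nhds hx₂] with x h₁ h₂
    simp only [Function.comp_apply]
    rw [ContinuousLinearMap.inCoordinates_eq h₁ h₂, ContinuousLinearMap.inCoordinates_eq h₂ h₁]
    simp [ContinuousLinearMap.inverse_equiv_comp, ContinuousLinearMap.inverse_comp_equiv,
      ContinuousLinearMap.comp_assoc]

end Inverse

set_option linter.unusedSectionVars false

section Calculus

variable {E : Type*} [NormedAddCommGroup E] [NormedSpace ℝ E]
  {H : Type*} [TopologicalSpace H] {I : ModelWithCorners ℝ E H}
  {M : Type*} [TopologicalSpace M] [ChartedSpace H M] [IsManifold I ∞ M]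
  {F : Type*} [NormedAddCommGroup F] [NormedSpace ℝ F]
  {A : M → Type*} [TopologicalSpace (TotalSpace F A)]
  [∀ x, AddCommGroup (A x)] [∀ x, Module ℝ (A x)] [∀ x, TopologicalSpace (A x)]
  [FiberBundle F A] [VectorBundle ℝ F A]
  [∀ x, IsTopologicalAddGroup (A x)] [∀ x, ContinuousSMul ℝ (A x)]

/-! ### Two-forms and endomorphisms -/

theorem PreLieAlgebroid.deriv_neg (μ : PreLieAlgebroid I F A) (X : Sec I F A) (f : M → ℝ)
    (x : M) : μ.deriv X (-f) x = -μ.deriv X f x := by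
  unfold PreLieAlgebroid.deriv
  rw [mvfderiv_neg]
  rfl

namespace TwoForm

theorem form_swap (Ω : TwoForm I F A) (x : M) (u v : A x) :
    (Ω.form x u v : ℝ) = -(Ω.form x v u : ℝ) := by
  have h := Ω.alternating x (u + v)
  simp only [map_add, add_apply, Ω.alternating] at h
  change (0 : ℝ) + (Ω.form x v u : ℝ) + ((Ω.form x u v : ℝ) + 0) = 0 at h
  linarith

theorem eval_swap (Ω : TwoForm I F A) (X Y : Sec I F A) : Ω.eval X Y = -Ω.eval Y X :=
  funext fun x => Ω.form_swap x (X x) (Y x)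

theorem deriv_eval_swap (μ : PreLieAlgebroid I F A) (Ω : TwoForm I F A) (X Y Z : Sec I F A)
    (x : M) : μ.deriv X (Ω.eval Y Z) x = -μ.deriv X (Ω.eval Z Y) x := by
  rw [Ω.eval_swap, μ.deriv_neg]

theorem eval_applySec_right {Ω : TwoForm I F A} {N : Endo I F A} (h : Ω.Commutes N)
    (X Y : Sec I F A) : Ω.eval X (applySec N Y) = Ω.eval (applySec N X) Y := by
  funext x
  have h1 : -(Ω.form x (N x (X x)) (Y x) : ℝ) = -(Ω.form x (X x) (N x (Y x)) : ℝ) :=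
    DFunLike.congr_fun (h x (X x)) (Y x)
  exact (neg_injective h1).symm

theorem eval_deform (Ω : TwoForm I F A) (N : Endo I F A) (h : Ω.Commutes N) (X Y : Sec I F A) :
    (Ω.deform N h).eval X Y = Ω.eval (applySec N X) Y := rfl

theorem Commutes.deform {Ω : TwoForm I F A} {N : Endo I F A} (h : Ω.Commutes N) :
    (Ω.deform N h).Commutes N := by
  intro x u
  rw [Ω.flat_deform N h x]
  exact h x (N x u)

theorem eval_add_left (Ω : TwoForm I F A) (X Y Z : Sec I F A) (x : M) :
    Ω.eval (X + Y) Z x = Ω.eval X Z x + Ω.eval Y Z x := by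
  simp [eval]

theorem eval_sub_left (Ω : TwoForm I F A) (X Y Z : Sec I F A) (x : M) :
    Ω.eval (X - Y) Z x = Ω.eval X Z x - Ω.eval Y Z x := by
  simp [eval]

theorem eval_neg_left (Ω : TwoForm I F A) (X Z : Sec I F A) (x : M) :
    Ω.eval (-X) Z x = -Ω.eval X Z x := by
  simp [eval]

theorem eval_bracket_swap (μ : PreLieAlgebroid I F A) (Ω : TwoForm I F A) (X Y Z : Sec I F A)
    (x : M) : Ω.eval (μ.bracket X Y) Z x = -Ω.eval (μ.bracket Y X) Z x := by
  rw [μ.bracket_skew, eval_neg_left]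

end TwoForm
/-! ### Differentials of deformed two-forms -/

theorem PreLieAlgebroid.deriv_deform (μ : PreLieAlgebroid I F A) (N : Endo I F A)
    (X : Sec I F A) (f : M → ℝ) (x : M) : (μ.deform N).deriv X f x = μ.deriv (applySec N X) f x := rfl

namespace TwoForm

theorem eval_deform_bracket (μ : PreLieAlgebroid I F A) (Ω : TwoForm I F A) (N : Endo I F A)
    (X Y Z : Sec I F A) (x : M) :
    Ω.eval ((μ.deform N).bracket X Y) Z x =
      Ω.eval (μ.bracket (applySec N X) Y) Z x + Ω.eval (μ.bracket X (applySec N Y)) Z x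
        - Ω.eval (applySec N (μ.bracket X Y)) Z x := by
  rw [← eval_add_left, ← eval_sub_left]
  rfl

/-- `d_{μ_N} Ω = i_N (d_μ Ω) - 2 d_μ Ω_N`: `d_{μ_N}` is the commutator of `i_N` with `d_μ`, and
`i_N Ω = 2 Ω_N`. -/
theorem differential_deform (μ : PreLieAlgebroid I F A) {Ω : TwoForm I F A} {N : Endo I F A}
    (h : Ω.Commutes N) (X Y Z : Sec I F A) (x : M) :
    Ω.differential (μ.deform N) X Y Z x =
      Ω.differential μ (applySec N X) Y Z x + Ω.differential μ X (applySec N Y) Z x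
        + Ω.differential μ X Y (applySec N Z) x
        - 2 * (Ω.deform N h).differential μ X Y Z x := by
  simp only [differential, eval_deform_bracket, μ.deriv_deform, eval_deform,
    eval_applySec_right h]
  ring

/-- The vanishing of the torsion of `N`, that is `[N X, N Y] = N [X, Y]_N`, paired with a section
by a two-form. -/
theorem eval_bracket_of_isNijenhuis {μ : PreLieAlgebroid I F A} (Ω : TwoForm I F A)
    {N : Endo I F A} (hN : μ.IsNijenhuis N) (X Y Z : Sec I F A) (x : M) :
    Ω.eval (μ.bracket (applySec N X) (applySec N Y)) Z x =
      Ω.eval (applySec N (μ.bracket (applySec N X) Y)) Z x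
        + Ω.eval (applySec N (μ.bracket X (applySec N Y))) Z x
        - Ω.eval (applySec N (applySec N (μ.bracket X Y))) Z x := by
  have h1 : Ω.eval (μ.torsion N X Y) Z x = 0 := by
    rw [hN X Y]; simp [eval]
  have h2 : applySec N (μ.bracket (applySec N X) Y + μ.bracket X (applySec N Y)) =
      applySec N (μ.bracket (applySec N X) Y) + applySec N (μ.bracket X (applySec N Y)) := by
    ext x; simp [applySec]
  rw [PreLieAlgebroid.torsion, h2, eval_add_left, eval_sub_left, eval_add_left] at h1
  linarith

/-- If `Ω` and `Ω_N` are closed and `N` is a Nijenhuis tensor, then the cyclic sum `S` of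
`ρ(N X) (Ω_N(Y, Z)) - Ω([N X, N Y], Z)` and the differential of `Ω_{N²}` both vanish. Indeed the
cyclic sums of `d Ω (N X, N Y, Z)` and of `d Ω_N (N X, Y, Z)` are `2 S + d Ω_{N²}` and
`S + 2 d Ω_{N²}`. -/
theorem cyclic_sum_and_differential_eq_zero {μ : PreLieAlgebroid I F A} {Ω : TwoForm I F A}
    {N : Endo I F A} (h : Ω.Commutes N) (hN : μ.IsNijenhuis N) (hΩ : Ω.IsClosed μ)
    (hΩN : (Ω.deform N h).IsClosed μ) (X Y Z : Sec I F A) (x : M) :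
    (μ.deriv (applySec N X) (Ω.eval (applySec N Y) Z) x
      + μ.deriv (applySec N Y) (Ω.eval (applySec N Z) X) x
      + μ.deriv (applySec N Z) (Ω.eval (applySec N X) Y) x
      - Ω.eval (μ.bracket (applySec N X) (applySec N Y)) Z x
      - Ω.eval (μ.bracket (applySec N Y) (applySec N Z)) X x
      - Ω.eval (μ.bracket (applySec N Z) (applySec N X)) Y x = 0) ∧
    ((Ω.deform N h).deform N h.deform).differential μ X Y Z x = 0 := by
  have a1 := hΩ (applySec N X) (applySec N Y) Z x
  have a2 := hΩ (applySec N Y) (applySec N Z) X x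
  have a3 := hΩ (applySec N Z) (applySec N X) Y x
  have b1 := hΩN (applySec N X) Y Z x
  have b2 := hΩN X (applySec N Y) Z x
  have b3 := hΩN X Y (applySec N Z) x
  have c1 := Ω.eval_bracket_of_isNijenhuis hN X Y Z x
  have c2 := Ω.eval_bracket_of_isNijenhuis hN Y Z X x
  have c3 := Ω.eval_bracket_of_isNijenhuis hN Z X Y x
  simp only [differential, eval_deform, eval_applySec_right h] at a1 a2 a3 b1 b2 b3 ⊢
  constructor <;> linarith

end TwoForm

/-! ### The Koszul bracket of a bivector related to a two-form -/

/-- The one-form `Ω^♭ X`. -/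
noncomputable def TwoForm.flatSec (Ω : TwoForm I F A) (X : Sec I F A) : OneForm I F A :=
  -applySec Ω.form X

namespace TwoForm

theorem pairing_flatSec (Ω : TwoForm I F A) (X Y : Sec I F A) :
    pairing (Ω.flatSec X) Y = -Ω.eval X Y := rfl

theorem transpose_flatSec {Ω : TwoForm I F A} {N : Endo I F A} (h : Ω.Commutes N)
    (X : Sec I F A) : transpose N (Ω.flatSec X) = Ω.flatSec (applySec N X) := by
  ext x : 1
  exact (h x (X x)).symm

end TwoForm

namespace Bivector

variable {P : Bivector I F A} {Ω : TwoForm I F A}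

/-- `P(Ω^♭ X, Ω^♭ Y)` and `[Ω^♭ X, Ω^♭ Y]_P` in terms of `Ω` alone, when `P^♯` sends `Ω^♭ X` and
`Ω^♭ Y` to `X'` and `Y'`. -/
theorem eval_and_koszul_flatSec (μ : PreLieAlgebroid I F A) {X Y X' Y' : Sec I F A}
    (hX : applySec P.sharp (Ω.flatSec X) = X') (hY : applySec P.sharp (Ω.flatSec Y) = Y')
    (Z : Sec I F A) (x : M) :
    P.eval (Ω.flatSec X) (Ω.flatSec Y) = Ω.eval X' Y ∧
    P.koszul μ (Ω.flatSec X) (Ω.flatSec Y) Z x =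
      -μ.deriv X' (Ω.eval Y Z) x - μ.deriv Y' (Ω.eval Z X) x - μ.deriv Z (Ω.eval X' Y) x
        + Ω.eval (μ.bracket Z X') Y x + Ω.eval (μ.bracket Y' Z) X x := by
  have he : P.eval (Ω.flatSec X) (Ω.flatSec Y) = Ω.eval X' Y := by
    rw [Ω.eval_swap X' Y, ← hX]
    rfl
  refine ⟨he, ?_⟩
  simp only [koszul, PreLieAlgebroid.lieDeriv, hX, hY, he, TwoForm.pairing_flatSec, μ.deriv_neg,
    Pi.neg_apply]
  have h1 := congrFun (Ω.eval_swap Y (μ.bracket X' Z)) x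
  have h2 := congrFun (Ω.eval_swap X (μ.bracket Y' Z)) x
  have h3 := Ω.eval_bracket_swap μ X' Z Y x
  have h4 := Ω.deriv_eval_swap μ Y' X Z x
  simp only [Pi.neg_apply] at h1 h2
  linarith

/-- If `P^♯ = (Ω^♭)⁻¹`, then `[Ω^♭ X, Ω^♭ Y]_P = Ω^♭ [X, Y]` up to the differential of `Ω`. -/
theorem koszul_flatSec_of_inverse (μ : PreLieAlgebroid I F A)
    (hP : ∀ X, applySec P.sharp (Ω.flatSec X) = X) (X Y Z : Sec I F A) (x : M) :
    P.koszul μ (Ω.flatSec X) (Ω.flatSec Y) Z x =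
      -Ω.eval (μ.bracket X Y) Z x - Ω.differential μ X Y Z x := by
  rw [(eval_and_koszul_flatSec μ (hP X) (hP Y) Z x).2, TwoForm.differential]
  ring

/-- If `P^♯ ∘ Ω^♭ = N`, then `[Ω^♭ X, Ω^♭ Y]_P = Ω^♭ [X, Y]_N` up to the differentials of `Ω` and
`Ω_N`. -/
theorem koszul_flatSec_of_endo (μ : PreLieAlgebroid I F A) {N : Endo I F A} (h : Ω.Commutes N)
    (hP : ∀ X, applySec P.sharp (Ω.flatSec X) = applySec N X) (X Y Z : Sec I F A) (x : M) :
    P.koszul μ (Ω.flatSec X) (Ω.flatSec Y) Z x =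
      -Ω.eval ((μ.deform N).bracket X Y) Z x
        - Ω.differential μ (applySec N X) Y Z x - Ω.differential μ X (applySec N Y) Z x
        + (Ω.deform N h).differential μ X Y Z x := by
  rw [(eval_and_koszul_flatSec μ (hP X) (hP Y) Z x).2]
  simp only [TwoForm.differential, TwoForm.eval_deform_bracket, TwoForm.eval_deform,
    TwoForm.eval_applySec_right h]
  ring

/-- For `P^♯ = (Ω^♭)⁻¹`, the Schouten bracket `[P, P]` is `-2 d Ω`. -/
theorem schouten_flatSec_of_inverse (μ : PreLieAlgebroid I F A)
    (hP : ∀ X, applySec P.sharp (Ω.flatSec X) = X) (X Y Z : Sec I F A) (x : M) :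
    P.schouten μ (Ω.flatSec X) (Ω.flatSec Y) (Ω.flatSec Z) x =
      -2 * Ω.differential μ X Y Z x := by
  have e (U V : Sec I F A) := (eval_and_koszul_flatSec μ (hP U) (hP V) Z x).1
  simp only [schouten, koszul_flatSec_of_inverse μ hP, hP, e, TwoForm.differential]
  ring

/-- If `Ω` and `Ω_N` are closed, `N` is a Nijenhuis tensor and `P^♯ ∘ Ω^♭ = N`, then `[P, P]`
vanishes on the image of `Ω^♭`. -/
theorem schouten_flatSec_of_endo {μ : PreLieAlgebroid I F A} {N : Endo I F A} (h : Ω.Commutes N)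
    (hN : μ.IsNijenhuis N) (hΩ : Ω.IsClosed μ) (hΩN : (Ω.deform N h).IsClosed μ)
    (hP : ∀ X, applySec P.sharp (Ω.flatSec X) = applySec N X) (X Y Z : Sec I F A) (x : M) :
    P.schouten μ (Ω.flatSec X) (Ω.flatSec Y) (Ω.flatSec Z) x = 0 := by
  have e (U V : Sec I F A) := (eval_and_koszul_flatSec μ (hP U) (hP V) Z x).1
  have hS := (TwoForm.cyclic_sum_and_differential_eq_zero h hN hΩ hΩN X Y Z x).1
  simp only [schouten, koszul_flatSec_of_endo μ h hP, hP, e, hΩ _ _ _ x, hΩN _ _ _ x,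
    TwoForm.eval_deform_bracket, TwoForm.eval_applySec_right h]
  simp only [Ω.eval_bracket_of_isNijenhuis hN] at hS
  linarith

end Bivector

/-! ### Non-degenerate two-forms and bivectors -/

theorem inverse_neg_of_isInvertible {V W : Type*} [AddCommGroup V] [Module ℝ V]
    [TopologicalSpace V] [IsTopologicalAddGroup V] [AddCommGroup W] [Module ℝ W]
    [TopologicalSpace W] [IsTopologicalAddGroup W] {T : V →L[ℝ] W} (hT : T.IsInvertible) :
    (-T).inverse = -T.inverse := by
  apply ContinuousLinearMap.inverse_eq
  · ext w
    simp [hT.self_apply_inverse]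
  · ext v
    simp [hT.inverse_apply_self]

variable [FiniteDimensional ℝ F]

namespace TwoForm

theorem Nondegenerate.isInvertible_flat {Ω : TwoForm I F A} (hnd : Ω.Nondegenerate) (x : M) :
    (Ω.flat x).IsInvertible :=
  haveI := FiniteDimensional.complete ℝ F
  isInvertible_of_bijective F (F →L[ℝ] ℝ) (hnd x)

theorem Nondegenerate.isInvertible_form {Ω : TwoForm I F A} (hnd : Ω.Nondegenerate) (x : M) :
    (Ω.form x).IsInvertible := by
  obtain ⟨e, he⟩ := hnd.isInvertible_flat x
  refine ⟨(ContinuousLinearEquiv.neg ℝ).trans e, ?_⟩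
  ext u v
  have h : (e u : DualBundle A x) = Ω.flat x u := DFunLike.congr_fun he u
  simp [h, flat]

/-- The bundle map `N ∘ (Ω^♭)⁻¹`. -/
noncomputable def sharpOfEndo (Ω : TwoForm I F A) (hnd : Ω.Nondegenerate) (N : Endo I F A) :
    Cₛ^∞⟮I; (F →L[ℝ] ℝ) →L[ℝ] F, fun x => DualBundle A x →L[ℝ] A x⟯ :=
  -- The sign is that of `Ω^♭ X = -i_X Ω`.
  -compSec N (haveI := FiniteDimensional.complete ℝ F
    invSec Ω.form fun x => (hnd.isInvertible_form x).bijective)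

theorem sharpOfEndo_apply (Ω : TwoForm I F A) (hnd : Ω.Nondegenerate) (N : Endo I F A) (x : M) :
    Ω.sharpOfEndo hnd N x = (N x).comp (Ω.flat x).inverse := by
  rw [flat, inverse_neg_of_isInvertible (hnd.isInvertible_form x), ContinuousLinearMap.comp_neg]
  rfl

theorem Nondegenerate.exists_flatSec_eq {Ω : TwoForm I F A} (hnd : Ω.Nondegenerate)
    (α : OneForm I F A) : ∃ X, Ω.flatSec X = α := by
  have := FiniteDimensional.complete ℝ F
  refine ⟨-applySec (invSec Ω.form fun x => (hnd.isInvertible_form x).bijective) α, ?_⟩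
  ext x : 1
  have h := (hnd.isInvertible_form x).self_apply_inverse (α x)
  change -(Ω.form x (-((Ω.form x).inverse (α x)))) = α x
  rw [map_neg, neg_neg, h]

end TwoForm

namespace Bivector

theorem Nondegenerate.isInvertible_sharp {P : Bivector I F A} (hnd : P.Nondegenerate) (x : M) :
    (P.sharp x).IsInvertible :=
  haveI := FiniteDimensional.complete ℝ F
  isInvertible_of_bijective (F →L[ℝ] ℝ) F (hnd x)

theorem Nondegenerate.isInvertible_neg_sharp {P : Bivector I F A} (hnd : P.Nondegenerate)
    (x : M) : ((-P.sharp) x).IsInvertible := by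
  obtain ⟨e, he⟩ := hnd.isInvertible_sharp x
  refine ⟨e.trans (ContinuousLinearEquiv.neg ℝ), ?_⟩
  ext α
  have h : e α = P.sharp x α := DFunLike.congr_fun he α
  simp [h]

/-- The two-form with `Ω^♭ = (P^♯)⁻¹`. -/
noncomputable def Nondegenerate.toTwoForm {P : Bivector I F A} (hnd : P.Nondegenerate) :
    TwoForm I F A where
  -- Inverting `-P^♯` provides the sign in `Ω^♭ X = -i_X Ω`.
  form :=
    haveI := FiniteDimensional.complete ℝ F
    invSec (-P.sharp) fun x => (hnd.isInvertible_neg_sharp x).bijective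
  alternating x u := by
    have h := (hnd.isInvertible_neg_sharp x).self_apply_inverse u
    have h2 := P.alternating x (((-P.sharp) x).inverse u)
    change ((-P.sharp) x).inverse u u = 0
    nth_rewrite 2 [← h]
    change ((-P.sharp) x).inverse u (-P.sharp x (((-P.sharp) x).inverse u)) = 0
    rw [map_neg, h2, neg_zero]

theorem Nondegenerate.flat_toTwoForm {P : Bivector I F A} (hnd : P.Nondegenerate) (x : M) :
    hnd.toTwoForm.flat x = (P.sharp x).inverse := by
  change -(-P.sharp x).inverse = _
  rw [inverse_neg_of_isInvertible (hnd.isInvertible_sharp x)]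
  exact neg_neg (P.sharp x).inverse

end Bivector

/-! ### The correspondence between the two kinds of structures -/

theorem IsOmegaN.exists_isPN {μ : LieAlgebroid I F A} {N : Endo I F A} {Ω : TwoForm I F A}
    (hΩ : IsOmegaN μ Ω N) (hnd : Ω.Nondegenerate) :
    ∃ P : Bivector I F A, (∀ x, P.sharp x = (N x).comp (Ω.flat x).inverse) ∧ IsPN μ P N := by
  have hc := hΩ.commutes
  have hflat (x : M) (α : DualBundle A x) : ∃ u, Ω.flat x u = α := (hnd x).2 α
  have hinv (x : M) (u : A x) : Ω.sharpOfEndo hnd N x (Ω.flat x u) = N x u := by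
    rw [TwoForm.sharpOfEndo_apply, ContinuousLinearMap.comp_apply,
      (hnd.isInvertible_flat x).inverse_apply_self]
  let P : Bivector I F A :=
    { sharp := Ω.sharpOfEndo hnd N
      alternating := by
        intro x α
        obtain ⟨u, rfl⟩ := hflat x α
        rw [hinv, ← ContinuousLinearMap.comp_apply, ← hc x u, ← ContinuousLinearMap.comp_apply,
          ← Ω.flat_deform N hc x]
        change -((Ω.deform N hc).form x u u : ℝ) = 0
        rw [(Ω.deform N hc).alternating, neg_zero] }
  have hP (X : Sec I F A) : applySec P.sharp (Ω.flatSec X) = applySec N X := by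
    ext x
    exact hinv x (X x)
  have hdef (X Y Z : Sec I F A) (x : M) :
      Ω.differential (μ.deform N) X Y Z x = 0 := by
    rw [TwoForm.differential_deform μ.toPreLieAlgebroid hc, hΩ.closed, hΩ.closed, hΩ.closed,
      hΩ.closed_deform]
    ring
  have hdef' (X Y Z : Sec I F A) (x : M) :
      (Ω.deform N hc).differential (μ.deform N) X Y Z x = 0 := by
    rw [TwoForm.differential_deform μ.toPreLieAlgebroid hc.deform, hΩ.closed_deform,
      hΩ.closed_deform, hΩ.closed_deform,
      (TwoForm.cyclic_sum_and_differential_eq_zero hc hΩ.nijenhuis hΩ.closed hΩ.closed_deform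
        X Y Z x).2]
    ring
  refine ⟨P, Ω.sharpOfEndo_apply hnd N, ?_, hΩ.nijenhuis, ?_, ?_⟩
  · intro α β γ x
    obtain ⟨X, rfl⟩ := hnd.exists_flatSec_eq α
    obtain ⟨Y, rfl⟩ := hnd.exists_flatSec_eq β
    obtain ⟨Z, rfl⟩ := hnd.exists_flatSec_eq γ
    exact Bivector.schouten_flatSec_of_endo hc hΩ.nijenhuis hΩ.closed hΩ.closed_deform hP X Y Z x
  · intro x α
    obtain ⟨u, rfl⟩ := hflat x α
    rw [← hc x u]
    exact (congrArg (N x) (hinv x u)).trans (hinv x (N x u)).symm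
  · intro α β Z x
    obtain ⟨X, rfl⟩ := hnd.exists_flatSec_eq α
    obtain ⟨Y, rfl⟩ := hnd.exists_flatSec_eq β
    -- Both sides are `Ω^♭` of the bracket `[X, Y]` deformed twice by `N`.
    rw [Bivector.koszul_flatSec_of_endo (μ.deform N) hc hP, hdef, hdef, hdef',
      Bivector.deformedKoszul, TwoForm.transpose_flatSec hc, TwoForm.transpose_flatSec hc]
    simp only [Bivector.koszul_flatSec_of_endo μ.toPreLieAlgebroid hc hP, hΩ.closed _ _ _ x,
      hΩ.closed_deform _ _ _ x, Ω.eval_applySec_right hc]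
    rw [TwoForm.eval_deform_bracket (μ.deform N)]
    ring

theorem IsPN.exists_isOmegaN {μ : LieAlgebroid I F A} {N : Endo I F A} {P : Bivector I F A}
    (hP : IsPN μ P N) (hnd : P.Nondegenerate) :
    ∃ Ω : TwoForm I F A, (∀ x, Ω.flat x = (P.sharp x).inverse.comp (N x)) ∧ IsOmegaN μ Ω N := by
  -- The inverse `Ω` of `P` is symplectic; the form sought is `Ω_N`.
  let Ω := hnd.toTwoForm
  have hflat (x : M) (α : DualBundle A x) : Ω.flat x (P.sharp x α) = α := by
    rw [hnd.flat_toTwoForm x]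
    exact (hnd.isInvertible_sharp x).inverse_apply_self α
  have hsharp (X : Sec I F A) : applySec P.sharp (Ω.flatSec X) = X := by
    ext x
    change P.sharp x (Ω.flat x (X x)) = X x
    rw [hnd.flat_toTwoForm x]
    exact (hnd.isInvertible_sharp x).self_apply_inverse (X x)
  have hc : Ω.Commutes N := by
    intro x u
    obtain ⟨α, rfl⟩ := (hnd x).2 u
    rw [hP.compatible.commutes x α, hflat, hflat]
  have hΩ : Ω.IsClosed μ.toPreLieAlgebroid := by
    intro X Y Z x
    have h := Bivector.schouten_flatSec_of_inverse μ.toPreLieAlgebroid hsharp X Y Z x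
    rw [hP.poisson] at h
    linarith
  have hdef (X Y Z : Sec I F A) (x : M) : Ω.differential (μ.deform N) X Y Z x = 0 := by
    have h := hP.compatible.bracket_eq (Ω.flatSec X) (Ω.flatSec Y) Z x
    rw [Bivector.koszul_flatSec_of_inverse _ hsharp, Bivector.deformedKoszul,
      TwoForm.transpose_flatSec hc, TwoForm.transpose_flatSec hc] at h
    simp only [Bivector.koszul_flatSec_of_inverse μ.toPreLieAlgebroid hsharp, hΩ _ _ _ x,
      Ω.eval_applySec_right hc, TwoForm.eval_deform_bracket] at h
    linarith
  have hΩN : (Ω.deform N hc).IsClosed μ.toPreLieAlgebroid := by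
    intro X Y Z x
    have h := TwoForm.differential_deform μ.toPreLieAlgebroid hc X Y Z x
    rw [hdef, hΩ, hΩ, hΩ] at h
    linarith
  refine ⟨Ω.deform N hc, fun x => ?_, hc.deform, hΩN, hP.nijenhuis, fun X Y Z x =>
    (TwoForm.cyclic_sum_and_differential_eq_zero hc hP.nijenhuis hΩ hΩN X Y Z x).2⟩
  rw [Ω.flat_deform N hc x, hnd.flat_toTwoForm x]

end Calculus

end LieAlgd

theorem mainTheorem2
    {E : Type*} [NormedAddCommGroup E] [NormedSpace ℝ E] [FiniteDimensional ℝ E]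
    {H : Type*} [TopologicalSpace H] (I : ModelWithCorners ℝ E H) [I.Boundaryless]
    {M : Type*} [TopologicalSpace M] [ChartedSpace H M] [IsManifold I ∞ M]
    [T2Space M] [SigmaCompactSpace M]
    (F : Type*) [NormedAddCommGroup F] [NormedSpace ℝ F] [FiniteDimensional ℝ F]
    (A : M → Type*) [TopologicalSpace (Bundle.TotalSpace F A)]
    [∀ x, AddCommGroup (A x)] [∀ x, Module ℝ (A x)] [∀ x, TopologicalSpace (A x)]
    [∀ x, IsTopologicalAddGroup (A x)] [∀ x, ContinuousSMul ℝ (A x)]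
    [FiberBundle F A] [VectorBundle ℝ F A] [ContMDiffVectorBundle ∞ F A I]
    (μ : LieAlgd.LieAlgebroid I F A) (N : LieAlgd.Endo I F A) :
    (∀ Ω : LieAlgd.TwoForm I F A, LieAlgd.IsOmegaN μ Ω N → Ω.Nondegenerate →
      ∃ P : LieAlgd.Bivector I F A,
        (∀ x, P.sharp x = (N x).comp (Ω.flat x).inverse) ∧ LieAlgd.IsPN μ P N) ∧
    (∀ P : LieAlgd.Bivector I F A, LieAlgd.IsPN μ P N → P.Nondegenerate →
      ∃ Ω : LieAlgd.TwoForm I F A,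
        (∀ x, Ω.flat x = ((P.sharp x).inverse).comp (N x)) ∧ LieAlgd.IsOmegaN μ Ω N) := by
  exact ⟨fun _ hΩ hnd => hΩ.exists_isPN hnd, fun _ hP hnd => hP.exists_isOmegaN hnd⟩
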